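/- Let $G$ be a ribbon graph with exactly one vertex and finite edge set $E$ (a surface, possibly non-orientable, obtained by gluing ribbons to the boundary of one disc; equivalently, a framed chord diagram on one circle). Its intersection matrix $M=M(G)\in\mathbb{F}_2^{E\times E}$ has diagonal entries $m_{ii}=1$ if the ribbon $i$ is twisted (forms a Möbius band together with the vertex) and $m_{ii}=0$ otherwise, and for $i\neq j$ it has $m_{ij}=1$ if the ends of the chords $i$ and $j$ alternate on the boundary circle of the vertex and $m_{ij}=0$ otherwise. For $J\subseteq E$ let $\mu_J(G)$ be the partial dual (Morse perestroika) of $G$ with respect to $J$: from the union of the boundary circles of the vertices remove the segments along which the ribbons of $J$ are attached and add the two other boundary arcs of each of these ribbons; attach new vertex discs to the circles so obtained, and keep the same ribbons. Let $J\subseteq E$ and $I=E\setminus J$, and write $$M=\begin{pmatrix}A&B\\ B^{*}&H\end{pmatrix}$$ in blocks, the rows and columns indexed by $I$ coming first and those indexed by $J$ last, where $B^*$ is the transpose of $B$. If $\det H\neq 0$ in $\mathbb{F}_2$, then the ribbon graph $\mu_J(G)$ has exactly one vertex, and its intersection matrix, in the same block form, is $$\begin{pmatrix}A+BH^{-1}B^{*}&BH^{-1}\\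 H^{-1}B^{*}&H^{-1}\end{pmatrix}.$$ -/

import Mathlib

/-- The corners of the ribbons of a ribbon graph with edge set `E`.  Every ribbon is a rectangle; its
corner `(e, a, s)` lies on the attaching segment number `a` of the ribbon `e` (a segment along
which `e` is glued to a vertex disc) and on the long side number `s` of `e` (an arc of the free
boundary of the ribbon).  So `{(e, a, false), (e, a, true)}` are the endpoints of an attaching
segment and `{(e, false, s), (e, true, s)}` are the endpoints of a side arc. -/
abbrev Corner (E : Type*) := E × Bool × Bool

/-- A ribbon graph (a surface cut into vertex discs and ribbons, possibly non-orientable, possibly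
disconnected, up to homeomorphisms preserving this decomposition) whose ribbons are labelled by
`E`.  The union of the boundaries of the vertex discs consists of the attaching segments and of the
free arcs between them; what has to be recorded is which corners are joined by a free arc, and how
many vertex discs meet no ribbon at all. -/
structure RibbonGraph (E : Type*) where
  /-- The other endpoint of the free arc of the vertex boundary that starts at a given corner. -/
  arc : Corner E → Corner E
  arc_arc : ∀ x, arc (arc x) = x
  arc_ne : ∀ x, arc x ≠ x
  /-- The number of vertices to which no ribbon is attached. -/
  isolated : ℕ

namespace RibbonGraph

variable {E : Type*}

/-- The other endpoint of the attaching segment of a given corner. -/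
def attach (x : Corner E) : Corner E := (x.1, x.2.1, !x.2.2)

/-- Two corners lie on the boundary circle of the same vertex disc: this boundary is made of
attaching segments and free arcs. -/
def vertexSetoid (G : RibbonGraph E) : Setoid (Corner E) :=
  Relation.EqvGen.setoid fun x y => y = attach x ∨ y = G.arc x

/-- The vertices of a ribbon graph: the boundary circles that carry corners, and the isolated
vertices. -/
def Vertex (G : RibbonGraph E) : Type _ := Quotient G.vertexSetoid ⊕ Fin G.isolated

/-- The ribbon graph has exactly one vertex (it is a framed one-component chord diagram). -/
def IsOneVertex (G : RibbonGraph E) : Prop := Nat.card G.Vertex = 1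

/-- Renaming of the corners of the ribbons in `J` by which attaching segments and side arcs exchange
their roles. -/
def swapCorner [DecidableEq E] (J : Finset E) (x : Corner E) : Corner E :=
  if x.1 ∈ J then (x.1, x.2.2, x.2.1) else x

theorem swapCorner_swapCorner [DecidableEq E] (J : Finset E) (x : Corner E) :
    swapCorner J (swapCorner J x) = x := by
  unfold swapCorner
  split_ifs <;> simp_all

/-- The partial dual (Morse perestroika) `μ_J(G)` with respect to a set `J` of ribbons: from the
union of the boundary circles of the vertices remove the attaching segments of the ribbons in `J`
and add their side arcs, keeping the free arcs; the new vertices are discs glued to the circles so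
obtained, and the ribbons remain the same.  A ribbon in `J` is thus attached to the new vertices
along its former side arcs, and its former attaching segments become its side arcs. -/
def partialDual [DecidableEq E] (G : RibbonGraph E) (J : Finset E) : RibbonGraph E where
  arc x := swapCorner J (G.arc (swapCorner J x))
  arc_arc x := by rw [swapCorner_swapCorner, G.arc_arc, swapCorner_swapCorner]
  arc_ne x h := by
    apply G.arc_ne (swapCorner J x)
    rw [← swapCorner_swapCorner J (G.arc (swapCorner J x)), h]
  isolated := G.isolated

/-- The partial dual with respect to a set is the composition of the partial duals with respect to
its elements. -/
theorem partialDual_insert [DecidableEq E] (G : RibbonGraph E) (J : Finset E) (e : E)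
    (he : e ∉ J) : G.partialDual (insert e J) = (G.partialDual J).partialDual {e} := by
  have h : ∀ x, swapCorner (insert e J) x = swapCorner J (swapCorner {e} x) := by
    intro x
    unfold swapCorner
    by_cases h1 : x.1 = e
    · simp [h1, he]
    · simp [h1]
  have h' : ∀ x, swapCorner (insert e J) x = swapCorner {e} (swapCorner J x) := by
    intro x
    unfold swapCorner
    by_cases h1 : x.1 = e
    · simp [h1, he]
    · by_cases h2 : x.1 ∈ J <;> simp [h1, h2]
  simp only [partialDual, RibbonGraph.mk.injEq, and_true]
  funext x
  rw [h', h]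

/-- Walking along the boundary of a vertex: from the corner at which one enters an attaching
segment, cross this segment and then the free arc after it, up to the corner at which one enters
the next attaching segment. -/
def step (G : RibbonGraph E) (x : Corner E) : Corner E := G.arc (attach x)

/-- The chords `i` and `j` of a one-vertex ribbon graph intersect: during one full turn along the
boundary circle of the vertex, starting from an end of `i`, one meets an end of `j`, then the other
end of `i`, then the other end of `j`. -/
def Intersect (G : RibbonGraph E) (i j : E) : Prop :=
  ∃ x : Corner E, ∃ p q r : ℕ,
    0 < p ∧ p < q ∧ q < r ∧ r < Function.minimalPeriod G.step x ∧
    x.1 = i ∧ (G.step^[p] x).1 = j ∧ (G.step^[q] x).1 = i ∧ (G.step^[r] x).1 = j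

/-- The chord `i` of a one-vertex ribbon graph is twisted (disoriented: together with the vertex it
forms a Möbius band): a walk along the boundary circle of the vertex enters the two attaching
segments of the ribbon at the two endpoints of one and the same side arc.  (For an orientable chord,
a side arc leads from the entrance of one attaching segment to the exit of the other one.) -/
def IsTwisted (G : RibbonGraph E) (i : E) : Prop :=
  ∃ k : ℕ, G.step^[k] (i, false, false) = (i, true, false)

open Classical in
/-- The intersection matrix over `𝔽₂` of a one-vertex ribbon graph (framed chord diagram). -/
noncomputable def intersectionMatrix (G : RibbonGraph E) : Matrix E E (ZMod 2) :=
  Matrix.of fun i j =>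
    if i = j then (if G.IsTwisted i then 1 else 0) else (if G.Intersect i j then 1 else 0)

/-- A square matrix written in block form: the rows and columns outside `J` come first, those in `J`
come last. -/
def blockForm (J : Finset E) (M : Matrix E E (ZMod 2)) :
    Matrix ({i // i ∉ J} ⊕ {j // j ∈ J}) ({i // i ∉ J} ⊕ {j // j ∈ J}) (ZMod 2) :=
  M.submatrix (Sum.elim Subtype.val Subtype.val) (Sum.elim Subtype.val Subtype.val)

end RibbonGraph

/-! Join the four corners of each ribbon to one point: the free arcs become the edges of a
four-valent graph. An `𝔽₂`-cycle `f` of this graph has at each ribbon two jumps, `x` across an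
attaching segment and `y` along a side arc; the pairs `(x, y)` form `isotropicSystem`. Partial
duality leaves the free arcs in place and exchanges `x e` with `y e` for `e ∈ J`.

If there is one vertex, the system is the graph of the intersection matrix
(`mem_isotropicSystem_iff`). The boundary arc between the two ends of a chord `j` is a cycle with
`x` the unit vector at `j` and `y` row `j` of the matrix; and `x = 0` makes a cycle constant along
the vertex boundary, so `y = 0`.

Exchanging the `J`-coordinates of such a graph, when `H` is invertible, gives the graph of the
pivoted matrix (`fromBlocks_mulVec_pivot`). Being a graph also forces the dual to have one vertex,
since the indicator of a vertex circle is a cycle with `x = 0`. -/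

namespace RibbonGraph

variable {E : Type*}

/-! ### Walks along the vertex boundary -/

theorem attach_attach (x : Corner E) : attach (attach x) = x := by
  simp [attach]

theorem attach_ne (x : Corner E) : attach x ≠ x := by
  intro h
  have := congrArg (fun y : Corner E => y.2.2) h
  simp [attach] at this

theorem eq_or_eq_attach_of_segment {u v : Corner E} (h₁ : u.1 = v.1) (h₂ : u.2.1 = v.2.1) :
    u = v ∨ u = attach v := by
  obtain ⟨e, a, s⟩ := u
  obtain ⟨e', a', s'⟩ := v
  cases s <;> cases s' <;> simp_all [attach]

theorem arc_attach (G : RibbonGraph E) (x : Corner E) : G.arc (attach x) = G.step x := rfl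

theorem arc_step (G : RibbonGraph E) (x : Corner E) : G.arc (G.step x) = attach x :=
  G.arc_arc _

theorem step_injective (G : RibbonGraph E) : Function.Injective G.step := by
  intro x y h
  have := congrArg G.arc h
  rw [arc_step, arc_step] at this
  simpa only [attach_attach] using congrArg attach this

theorem step_attach_step (G : RibbonGraph E) (x : Corner E) :
    G.step (attach (G.step x)) = attach x := by
  rw [step, attach_attach, arc_step]

/-- `attach` conjugates `step` to its inverse, so an equality for `n + 2` steps from `x` shortens to
one for `n` steps from `G.step x`. This ends at a fixed point of `attach` or of `arc`. -/
theorem iterate_step_ne_attach (G : RibbonGraph E) (n : ℕ) :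
    ∀ x : Corner E, G.step^[n] x ≠ attach x := by
  induction n using Nat.twoStepInduction with
  | zero => exact fun x h => attach_ne x h.symm
  | one => exact fun x h => G.arc_ne (attach x) h
  | more n ih _ =>
    intro x h
    rw [Function.iterate_succ_apply', ← G.step_attach_step] at h
    exact ih _ (G.step_injective h)

/-- The two directions in which the boundary of a vertex can be walked along have no corner in
common. -/
theorem iterate_step_ne_attach_iterate (G : RibbonGraph E) (m n : ℕ) (x : Corner E) :
    G.step^[m] x ≠ attach (G.step^[n] x) := by
  intro h
  rcases le_total n m with hnm | hmn
  · obtain ⟨d, rfl⟩ := Nat.exists_eq_add_of_le' hnm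
    rw [Function.iterate_add_apply] at h
    exact G.iterate_step_ne_attach _ _ h
  · obtain ⟨d, rfl⟩ := Nat.exists_eq_add_of_le' hmn
    rw [Function.iterate_add_apply] at h
    apply G.iterate_step_ne_attach d (G.step^[m] x)
    rw [h, attach_attach, ← h]

theorem IsOneVertex.subsingleton {G : RibbonGraph E} (hG : G.IsOneVertex) :
    Subsingleton G.Vertex :=
  (Nat.card_eq_one_iff_unique.mp hG).1

theorem IsOneVertex.vertexSetoid_apply {G : RibbonGraph E} (hG : G.IsOneVertex) (z w : Corner E) :
    G.vertexSetoid z w := by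
  have h : (Sum.inl (Quotient.mk G.vertexSetoid z) : G.Vertex) =
      Sum.inl (Quotient.mk G.vertexSetoid w) := @Subsingleton.elim _ hG.subsingleton _ _
  exact Quotient.exact (Sum.inl.inj h)

/-- A function on the corners of a one-vertex ribbon graph that does not change along free arcs and
attaching segments is constant. -/
theorem IsOneVertex.eq_of_invariant {G : RibbonGraph E} (hG : G.IsOneVertex) {α : Type*}
    {f : Corner E → α} (harc : ∀ z, f (G.arc z) = f z) (hatt : ∀ z, f (attach z) = f z)
    (z w : Corner E) : f z = f w := by
  have h' : Relation.EqvGen (fun x y => y = attach x ∨ y = G.arc x) z w :=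
    hG.vertexSetoid_apply z w
  induction h' with
  | rel x y hxy =>
    rcases hxy with rfl | rfl
    · exact (hatt x).symm
    · exact (harc x).symm
  | refl x => rfl
  | symm x y _ ih => exact ih.symm
  | trans x y z _ _ ih₁ ih₂ => exact ih₁.trans ih₂

theorem iterate_step_inj {G : RibbonGraph E} (x : Corner E) {s t : ℕ}
    (hs : s < Function.minimalPeriod G.step x) (ht : t < Function.minimalPeriod G.step x)
    (h : G.step^[s] x = G.step^[t] x) : s = t :=
  Function.iterate_injOn_Iio_minimalPeriod hs ht h

/-- During one turn along the boundary of a vertex each attaching segment is met at most once. -/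
theorem eq_of_segment_iterate_step {G : RibbonGraph E} (x : Corner E) {s t : ℕ} (hs : s < Function.minimalPeriod G.step x)
    (ht : t < Function.minimalPeriod G.step x) (h₁ : (G.step^[s] x).1 = (G.step^[t] x).1)
    (h₂ : (G.step^[s] x).2.1 = (G.step^[t] x).2.1) : s = t := by
  rcases eq_or_eq_attach_of_segment h₁ h₂ with h | h
  · exact iterate_step_inj x hs ht h
  · exact absurd h (G.iterate_step_ne_attach_iterate s t x)

section Walk

variable [Finite E] (G : RibbonGraph E) (x : Corner E)

theorem minimalPeriod_step_pos : 0 < Function.minimalPeriod G.step x :=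
  Function.minimalPeriod_pos_of_mem_periodicPts (G.step_injective.mem_periodicPts x)

variable {G}

theorem IsOneVertex.exists_iterate_step (hG : G.IsOneVertex) (z : Corner E) :
    ∃ t < Function.minimalPeriod G.step x, z = G.step^[t] x ∨ z = attach (G.step^[t] x) := by
  have hN := G.minimalPeriod_step_pos x
  suffices h : ∃ t, z = G.step^[t] x ∨ z = attach (G.step^[t] x) by
    obtain ⟨t, ht⟩ := h
    refine ⟨t % _, Nat.mod_lt _ hN, ?_⟩
    rwa [Function.iterate_mod_minimalPeriod_eq]
  let P : Corner E → Prop := fun z => ∃ t, z = G.step^[t] x ∨ z = attach (G.step^[t] x)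
  have hatt : ∀ z, P z → P (attach z) := by
    rintro z ⟨t, rfl | rfl⟩
    · exact ⟨t, Or.inr rfl⟩
    · exact ⟨t, Or.inl (attach_attach _)⟩
  have harc : ∀ z, P z → P (G.arc z) := by
    rintro z ⟨t, rfl | rfl⟩
    -- One step back from `t`, taken modulo the period so that `t = 0` is covered.
    · refine ⟨t + (Function.minimalPeriod G.step x - 1), Or.inr ?_⟩
      rw [← arc_step, ← Function.iterate_succ_apply' G.step]
      rw [show (t + (Function.minimalPeriod G.step x - 1)).succ
        = t + Function.minimalPeriod G.step x by omega, Function.iterate_add_apply,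
        Function.iterate_minimalPeriod]
    · exact ⟨t + 1, Or.inl (by rw [arc_attach, Function.iterate_succ_apply'])⟩
  have key : P z = P x := hG.eq_of_invariant (f := P)
    (fun z => propext ⟨fun h => by simpa only [G.arc_arc] using harc _ h, harc z⟩)
    (fun z => propext ⟨fun h => by simpa only [attach_attach] using hatt _ h, hatt z⟩) z x
  exact key.mpr ⟨0, Or.inl rfl⟩

/-- During one turn along the boundary of the vertex each attaching segment is met. -/
theorem IsOneVertex.exists_segment (hG : G.IsOneVertex) (i : E) (a : Bool) :
    ∃ t < Function.minimalPeriod G.step x, (G.step^[t] x).1 = i ∧ (G.step^[t] x).2.1 = a := by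
  obtain ⟨t, ht, h | h⟩ := hG.exists_iterate_step x (i, a, false)
  · exact ⟨t, ht, by rw [← h], by rw [← h]⟩
  · refine ⟨t, ht, ?_, ?_⟩
    · exact (congrArg Prod.fst h).symm
    · exact (congrArg (fun z : Corner E => z.2.1) h).symm

theorem IsOneVertex.exists_return (hG : G.IsOneVertex) :
    ∃ k, 0 < k ∧ k < Function.minimalPeriod G.step x ∧
      ∀ t < Function.minimalPeriod G.step x, (G.step^[t] x).1 = x.1 ↔ t = 0 ∨ t = k := by
  obtain ⟨k, hk, h₁, h₂⟩ := hG.exists_segment x x.1 (!x.2.1)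
  refine ⟨k, ?_, hk, fun t ht => ⟨fun h => ?_, ?_⟩⟩
  · rcases Nat.eq_zero_or_pos k with rfl | h
    · simp at h₂
    · exact h
  · by_cases hb : (G.step^[t] x).2.1 = x.2.1
    · exact Or.inl (eq_of_segment_iterate_step x ht (G.minimalPeriod_step_pos x) h hb)
    · refine Or.inr (eq_of_segment_iterate_step x ht hk (h.trans h₁.symm) ?_)
      rw [h₂]
      exact Bool.eq_not.mpr hb
  · rintro (rfl | rfl)
    · rfl
    · exact h₁

end Walk

/-! ### The cycle cut out by a chord -/

open Classical in
/-- The indicator function of the part of the vertex boundary traversed during the first `k` steps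
of a walk, on corners. -/
noncomputable def walkIndicator (G : RibbonGraph E) (x : Corner E) (k : ℕ) (z : Corner E) :
    ZMod 2 :=
  if ∃ t < k, z = G.step^[t + 1] x ∨ z = attach (G.step^[t] x) then 1 else 0

/-- For each `t` the two corners listed in the indicator are the ends of one free arc. -/
theorem walkIndicator_arc (G : RibbonGraph E) (x : Corner E) (k : ℕ) (z : Corner E) :
    G.walkIndicator x k (G.arc z) = G.walkIndicator x k z := by
  unfold walkIndicator
  congr 1
  refine propext (exists_congr fun t => and_congr_right fun _ => ?_)
  rw [or_comm, Function.iterate_succ_apply']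
  refine or_congr ?_ ?_
  · rw [← arc_step]
    exact ⟨fun h => by rw [← G.arc_arc z, h, G.arc_arc], fun h => by rw [h]⟩
  · rw [← arc_attach]
    exact ⟨fun h => by rw [← G.arc_arc z, h, G.arc_arc], fun h => by rw [h]⟩

theorem walkIndicator_iterate (G : RibbonGraph E) (x : Corner E) {k t : ℕ}
    (hk : k < Function.minimalPeriod G.step x) (ht : t < Function.minimalPeriod G.step x) :
    G.walkIndicator x k (G.step^[t] x) = if 0 < t ∧ t ≤ k then 1 else 0 := by
  unfold walkIndicator
  congr 1
  refine propext ⟨?_, ?_⟩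
  · rintro ⟨s, hs, h | h⟩
    · have := Function.iterate_injOn_Iio_minimalPeriod (f := G.step) (x := x) ht
        (show s + 1 < Function.minimalPeriod G.step x by omega) h
      omega
    · exact absurd h (G.iterate_step_ne_attach_iterate _ _ x)
  · rintro ⟨h₁, h₂⟩
    exact ⟨t - 1, by omega, Or.inl (by rw [Nat.sub_add_cancel h₁])⟩

theorem walkIndicator_attach_iterate (G : RibbonGraph E) (x : Corner E) {k t : ℕ}
    (hk : k < Function.minimalPeriod G.step x) (ht : t < Function.minimalPeriod G.step x) :
    G.walkIndicator x k (attach (G.step^[t] x)) = if t < k then 1 else 0 := by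
  unfold walkIndicator
  congr 1
  refine propext ⟨?_, fun h => ⟨t, h, Or.inr rfl⟩⟩
  rintro ⟨s, hs, h | h⟩
  · exact absurd h.symm (G.iterate_step_ne_attach_iterate _ _ x)
  · have h' := congrArg attach h
    rw [attach_attach, attach_attach] at h'
    have := Function.iterate_injOn_Iio_minimalPeriod (f := G.step) (x := x) ht
      (show s < Function.minimalPeriod G.step x by omega) h'
    omega

/-- Intersection of the chord that ends at the corner `x` with the chord `i`, read off from the walk
starting at `x`. -/
def CrossesFrom (G : RibbonGraph E) (x : Corner E) (i : E) : Prop :=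
  ∃ p q r : ℕ, 0 < p ∧ p < q ∧ q < r ∧ r < Function.minimalPeriod G.step x ∧
    (G.step^[p] x).1 = i ∧ (G.step^[q] x).1 = x.1 ∧ (G.step^[r] x).1 = i

theorem intersect_iff_exists_crossesFrom (G : RibbonGraph E) (j i : E) :
    G.Intersect j i ↔ ∃ x : Corner E, x.1 = j ∧ G.CrossesFrom x i := by
  constructor
  · rintro ⟨x, p, q, r, h₁, h₂, h₃, h₄, h₅, h₆, h₇, h₈⟩
    exact ⟨x, h₅, p, q, r, h₁, h₂, h₃, h₄, h₆, h₇.trans h₅.symm, h₈⟩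
  · rintro ⟨x, rfl, p, q, r, h₁, h₂, h₃, h₄, h₅, h₆, h₇⟩
    exact ⟨x, p, q, r, h₁, h₂, h₃, h₄, rfl, h₅, h₆, h₇⟩

theorem Intersect.symm [Finite E] {G : RibbonGraph E} {i j : E} (h : G.Intersect i j) :
    G.Intersect j i := by
  obtain ⟨x, p, q, r, h₁, h₂, h₃, h₄, h₅, h₆, h₇, h₈⟩ := h
  have hx := G.step_injective.mem_periodicPts x
  -- The walk restarts at the first end of `j`; the last meeting is the return to `x` after a full
  -- turn.
  refine ⟨G.step^[p] x, q - p, r - p, Function.minimalPeriod G.step x - p, by omega, by omega,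
    by omega, ?_, h₆, ?_, ?_, ?_⟩
  · rw [Function.minimalPeriod_apply_iterate hx]
    omega
  · rw [← Function.iterate_add_apply, Nat.sub_add_cancel h₂.le, h₇]
  · rw [← Function.iterate_add_apply, Nat.sub_add_cancel (by omega), h₈]
  · rw [← Function.iterate_add_apply, Nat.sub_add_cancel (by omega),
      Function.iterate_minimalPeriod, h₅]

theorem intersectionMatrix_isSymm [Finite E] (G : RibbonGraph E) :
    G.intersectionMatrix.IsSymm := by
  ext i j
  have h : G.Intersect j i ↔ G.Intersect i j := ⟨Intersect.symm, Intersect.symm⟩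
  by_cases hij : i = j
  · simp [hij]
  · simp only [intersectionMatrix, Matrix.transpose_apply, Matrix.of_apply, if_neg hij,
      if_neg (Ne.symm hij)]
    congr 1
    exact propext h

/-! ### Cycles, jumps and the isotropic system -/

/-- The difference of the values of `f` at the ends of an attaching segment and at the ends of a
side arc of each ribbon. -/
def jump : (Corner E → ZMod 2) →ₗ[ZMod 2] (E → ZMod 2) × (E → ZMod 2) where
  toFun f := (fun e => f (e, false, false) + f (e, false, true),
    fun e => f (e, false, false) + f (e, true, false))
  map_add' f g := by
    ext e <;> simp <;> ring
  map_smul' c f := by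
    ext e <;> simp <;> ring

/-- The cycle space over `𝔽₂` of the four-valent graph whose vertices are the ribbons and whose edges
are the free arcs. -/
def cycleSpace (G : RibbonGraph E) : Submodule (ZMod 2) (Corner E → ZMod 2) where
  carrier := {f | (∀ z, f (G.arc z) = f z) ∧ ∀ e, f (e, false, false) + f (e, false, true) +
    f (e, true, false) + f (e, true, true) = 0}
  zero_mem' := by simp
  add_mem' := by
    rintro f g ⟨hf, hf'⟩ ⟨hg, hg'⟩
    refine ⟨fun z => by simp [hf, hg], fun e => ?_⟩
    simp only [Pi.add_apply]
    linear_combination hf' e + hg' e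
  smul_mem' := by
    rintro c f ⟨hf, hf'⟩
    refine ⟨fun z => by simp [hf], fun e => ?_⟩
    simp only [Pi.smul_apply, smul_eq_mul]
    linear_combination c * hf' e

/-- The isotropic system of a ribbon graph: the possible jumps of the cycles. -/
def isotropicSystem (G : RibbonGraph E) : Submodule (ZMod 2) ((E → ZMod 2) × (E → ZMod 2)) :=
  G.cycleSpace.map jump

theorem zmod_two_add_eq_zero {a b : ZMod 2} : a + b = 0 ↔ a = b := by
  rw [← CharTwo.sub_eq_add, sub_eq_zero]

theorem apply_attach_eq {f : Corner E → ZMod 2}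
    (hf : ∀ e, f (e, false, false) + f (e, false, true) + f (e, true, false) + f (e, true, true) = 0)
    (hx : ∀ e, f (e, false, false) + f (e, false, true) = 0) (z : Corner E) :
    f (attach z) = f z := by
  obtain ⟨e, a, s⟩ := z
  have h₁ := hx e
  have h₂ := hf e
  rw [h₁, zero_add] at h₂
  rw [zmod_two_add_eq_zero] at h₁ h₂
  cases a <;> cases s <;> simp [attach, h₁, h₂]

theorem IsOneVertex.snd_eq_zero_of_mem_isotropicSystem {G : RibbonGraph E} (hG : G.IsOneVertex)
    {y : E → ZMod 2} (h : (0, y) ∈ G.isotropicSystem) : y = 0 := by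
  obtain ⟨f, ⟨harc, hf⟩, hfy⟩ := h
  obtain ⟨hx, rfl⟩ := Prod.ext_iff.mp hfy
  have hc := hG.eq_of_invariant harc (apply_attach_eq hf (congrFun hx))
  ext e
  exact zmod_two_add_eq_zero.mpr (hc _ _)

open Classical in
/-- The part of the boundary of the vertex between the two ends of a chord is a cycle that jumps
exactly at this chord. -/
theorem IsOneVertex.exists_chord_cycle [Finite E] {G : RibbonGraph E} (hG : G.IsOneVertex)
    (x : Corner E) :
    ∃ f : Corner E → ZMod 2, (∀ z, f (G.arc z) = f z) ∧
      (∀ z, f z + f (attach z) = if z.1 = x.1 then 1 else 0) ∧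
      (∀ i ≠ x.1, f (i, false, false) + f (i, true, false) =
        if G.CrossesFrom x i then 1 else 0) ∧
      f x + f (x.1, !x.2.1, x.2.2) =
        if ∃ k, G.step^[k] x = (x.1, !x.2.1, x.2.2) then 1 else 0 := by
  obtain ⟨k, hk₀, hk, hret⟩ := hG.exists_return x
  set N := Function.minimalPeriod G.step x with hN
  have hval {t : ℕ} (ht : t < N) := G.walkIndicator_iterate x hk ht
  have hval' {t : ℕ} (ht : t < N) := G.walkIndicator_attach_iterate x hk ht
  have hjump (z : Corner E) :
      G.walkIndicator x k z + G.walkIndicator x k (attach z) = if z.1 = x.1 then 1 else 0 := by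
    have main {t : ℕ} (ht : t < N) :
        G.walkIndicator x k (G.step^[t] x) + G.walkIndicator x k (attach (G.step^[t] x)) =
          if (G.step^[t] x).1 = x.1 then 1 else 0 := by
      rw [hval ht, hval' ht, if_congr (hret t ht) rfl rfl]
      split_ifs <;> first | omega | decide
    obtain ⟨t, ht, rfl | rfl⟩ := hG.exists_iterate_step x z
    · exact main ht
    · rw [attach_attach, add_comm]
      exact main ht
  refine ⟨G.walkIndicator x k, G.walkIndicator_arc x k, hjump, fun i hi => ?_, ?_⟩
  · have hatt {z : Corner E} (hz : z.1 = i) :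
        G.walkIndicator x k (attach z) = G.walkIndicator x k z := by
      have := hjump z
      rw [if_neg (hz ▸ hi), zmod_two_add_eq_zero] at this
      exact this.symm
    have hseg {z : Corner E} {a : Bool} (hz : z.1 = i) (hz' : z.2.1 = a) :
        G.walkIndicator x k (i, a, false) = G.walkIndicator x k z := by
      rcases eq_or_eq_attach_of_segment (u := (i, a, false)) (v := z) hz.symm hz'.symm with h | h
      · rw [h]
      · rw [h, hatt hz]
    obtain ⟨p, hp, hp₁, hp₂⟩ := hG.exists_segment x i false
    obtain ⟨q, hq, hq₁, hq₂⟩ := hG.exists_segment x i true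
    have honly {t : ℕ} (ht : t < N) (hti : (G.step^[t] x).1 = i) : t = p ∨ t = q := by
      cases hb : (G.step^[t] x).2.1
      · exact Or.inl (eq_of_segment_iterate_step x ht hp (hti.trans hp₁.symm) (hb.trans hp₂.symm))
      · exact Or.inr (eq_of_segment_iterate_step x ht hq (hti.trans hq₁.symm) (hb.trans hq₂.symm))
    have hp0 : ¬ (p = 0 ∨ p = k) := fun h => hi (hp₁.symm.trans ((hret p hp).mpr h))
    have hq0 : ¬ (q = 0 ∨ q = k) := fun h => hi (hq₁.symm.trans ((hret q hq).mpr h))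
    -- The chords cross iff exactly one end of `i` is met before the return time `k`.
    have hcross : G.CrossesFrom x i ↔ (p < k ∧ k < q) ∨ (q < k ∧ k < p) := by
      constructor
      · rintro ⟨p', q', r', h₁, h₂, h₃, h₄, h₅, h₆, h₇⟩
        have e₁ := (hret q' (by omega)).mp h₆
        have e₂ := honly (by omega) h₅
        have e₃ := honly h₄ h₇
        omega
      · have hkx := (hret k hk).mpr (Or.inr rfl)
        rintro (⟨h₁, h₂⟩ | ⟨h₁, h₂⟩)
        · exact ⟨p, k, q, by omega, h₁, h₂, hq, hp₁, hkx, hq₁⟩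
        · exact ⟨q, k, p, by omega, h₁, h₂, hp, hq₁, hkx, hp₁⟩
    rw [hseg hp₁ hp₂, hseg hq₁ hq₂, hval hp, hval hq, if_congr hcross rfl rfl]
    split_ifs <;> first | omega | decide
  · have hx : G.walkIndicator x k x = 0 := by
      simpa using hval (t := 0) (by omega)
    obtain ⟨t, ht, h⟩ := hG.exists_iterate_step x (x.1, !x.2.1, x.2.2)
    have hseg : (G.step^[t] x).1 = x.1 ∧ (G.step^[t] x).2.1 = !x.2.1 := by
      rcases h with h | h
      · rw [← h]
        exact ⟨rfl, rfl⟩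
      · exact ⟨(congrArg Prod.fst h).symm, (congrArg (fun z : Corner E => z.2.1) h).symm⟩
    -- The other end of the chord is met at time `k`, where the traversed part stops: the entrance
    -- corner has value 1, the exit corner 0.
    obtain rfl : t = k := by
      refine ((hret t ht).mp hseg.1).resolve_left ?_
      rintro rfl
      simpa using hseg.2
    rw [hx, zero_add]
    rcases h with h | h
    · rw [h, hval ht, if_pos ⟨hk₀, le_rfl⟩, if_pos ⟨t, rfl⟩]
    · rw [h, hval' ht, if_neg (lt_irrefl t), if_neg]
      rintro ⟨s, hs⟩
      exact G.iterate_step_ne_attach_iterate _ _ x hs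

open Classical in
theorem IsOneVertex.exists_mem_isotropicSystem [Finite E] {G : RibbonGraph E}
    (hG : G.IsOneVertex) (x : Corner E) :
    ∃ y, (Pi.single x.1 1, y) ∈ G.isotropicSystem ∧
      (∀ i ≠ x.1, y i = if G.CrossesFrom x i then 1 else 0) ∧
      (x.2 = (false, false) → y x.1 = if G.IsTwisted x.1 then 1 else 0) := by
  obtain ⟨f, harc, hjump, hcross, htwist⟩ := hG.exists_chord_cycle x
  refine ⟨(jump f).2, ⟨f, ⟨harc, fun e => ?_⟩, Prod.ext (funext fun e => ?_) rfl⟩, hcross, ?_⟩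
  · have h₁ := hjump (e, false, false)
    have h₂ := hjump (e, true, false)
    simp only [attach, Bool.not_false] at h₁ h₂
    rw [add_assoc, h₁, h₂]
    exact CharTwo.add_self_eq_zero _
  · change _ = (Pi.single x.1 1 : E → ZMod 2) e
    rw [Pi.single_apply]
    exact hjump (e, false, false)
  · obtain ⟨j, a, s⟩ := x
    rintro ⟨⟩
    exact htwist

theorem IsOneVertex.single_mem_isotropicSystem [Finite E] [DecidableEq E] {G : RibbonGraph E}
    (hG : G.IsOneVertex) (j : E) :
    (Pi.single j 1, G.intersectionMatrix j) ∈ G.isotropicSystem := by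
  classical
  obtain ⟨y, hy, hcross, htwist⟩ := hG.exists_mem_isotropicSystem (j, false, false)
  -- The side jumps are determined by the unit vector at `j`, so crossing does not depend on the end
  -- or direction from which the walk starts.
  have huniq (x : Corner E) (hx : x.1 = j) (i : E) (hi : i ≠ j) :
      y i = if G.CrossesFrom x i then 1 else 0 := by
    subst hx
    obtain ⟨y', hy', hcross', -⟩ := hG.exists_mem_isotropicSystem x
    have := G.isotropicSystem.sub_mem hy hy'
    rw [Prod.mk_sub_mk, sub_self] at this
    rw [sub_eq_zero.mp (hG.snd_eq_zero_of_mem_isotropicSystem this), hcross' i hi]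
  have hM : G.intersectionMatrix j = y := by
    ext i
    by_cases hij : j = i
    · subst hij
      simpa [intersectionMatrix] using (htwist rfl).symm
    · have h : G.Intersect j i ↔ G.CrossesFrom (j, false, false) i := by
        rw [intersect_iff_exists_crossesFrom]
        refine ⟨?_, fun h => ⟨_, rfl, h⟩⟩
        rintro ⟨x, hx, h⟩
        have h' := huniq x hx i (Ne.symm hij)
        rw [if_pos h, hcross i (Ne.symm hij)] at h'
        by_contra hc
        simp [hc] at h'
      rw [hcross i (Ne.symm hij)]
      simp [intersectionMatrix, hij, h]
  rw [hM]
  convert hy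

/-- The isotropic system of a one-vertex ribbon graph is the graph of its intersection matrix. -/
theorem IsOneVertex.mem_isotropicSystem_iff [Fintype E] {G : RibbonGraph E}
    (hG : G.IsOneVertex) (x y : E → ZMod 2) :
    (x, y) ∈ G.isotropicSystem ↔ y = G.intersectionMatrix.mulVec x := by
  classical
  have hmem : (x, G.intersectionMatrix.mulVec x) ∈ G.isotropicSystem := by
    have h : (x, G.intersectionMatrix.mulVec x) =
        ∑ j, x j • ((Pi.single j 1, G.intersectionMatrix j) : (E → ZMod 2) × (E → ZMod 2)) := by
      refine Prod.ext ?_ ?_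
      · ext e
        simp [Prod.fst_sum, Pi.single_apply]
      · ext e
        simp only [Prod.snd_sum, Prod.smul_snd, Finset.sum_apply, Pi.smul_apply, smul_eq_mul,
          Matrix.mulVec, dotProduct]
        refine Finset.sum_congr rfl fun j _ => ?_
        rw [mul_comm, G.intersectionMatrix_isSymm.apply j e]
    rw [h]
    exact Submodule.sum_mem _ fun j _ =>
      Submodule.smul_mem _ _ (hG.single_mem_isotropicSystem j)
  refine ⟨fun h => ?_, fun h => h ▸ hmem⟩
  have := G.isotropicSystem.sub_mem h hmem
  rw [Prod.mk_sub_mk, sub_self] at this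
  exact sub_eq_zero.mp (hG.snd_eq_zero_of_mem_isotropicSystem this)

/-! ### Partial duality on isotropic systems -/

theorem partialDual_partialDual [DecidableEq E] (G : RibbonGraph E) (J : Finset E) :
    (G.partialDual J).partialDual J = G := by
  simp [partialDual, swapCorner_swapCorner]

/-- The partial dual exchanges the two kinds of jumps at the ribbons of `J`. -/
theorem mem_isotropicSystem_partialDual [DecidableEq E] (G : RibbonGraph E) (J : Finset E)
    {x y : E → ZMod 2} (h : (x, y) ∈ G.isotropicSystem) :
    (J.piecewise y x, J.piecewise x y) ∈ (G.partialDual J).isotropicSystem := by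
  obtain ⟨f, ⟨harc, hf⟩, hxy⟩ := h
  obtain ⟨rfl, rfl⟩ := Prod.ext_iff.mp hxy
  refine ⟨fun z => f (swapCorner J z), ⟨fun z => ?_, fun e => ?_⟩, Prod.ext ?_ ?_⟩
  · simp only [partialDual, swapCorner_swapCorner, harc]
  · by_cases he : e ∈ J
    · simp only [swapCorner, he, if_true]
      linear_combination hf e
    · simpa only [swapCorner, he, if_false] using hf e
  all_goals
    ext e
    by_cases he : e ∈ J <;> simp [jump, swapCorner, he]

theorem mem_isotropicSystem_partialDual_iff [DecidableEq E] (G : RibbonGraph E) (J : Finset E)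
    {x y : E → ZMod 2} :
    (x, y) ∈ (G.partialDual J).isotropicSystem ↔
      (J.piecewise y x, J.piecewise x y) ∈ G.isotropicSystem := by
  constructor
  · intro h
    simpa only [partialDual_partialDual] using mem_isotropicSystem_partialDual _ J h
  · intro h
    convert mem_isotropicSystem_partialDual _ J h using 2 <;>
    · ext e
      by_cases he : e ∈ J <;> simp [he]

/-- The indicator of a vertex circle of the dual has no attaching jump, hence by `h` no side jump.
It is then constant on every ribbon, insensitive to `swapCorner`, and so invariant along the
boundary of the single vertex of `G`. -/
theorem IsOneVertex.partialDual [Fintype E] [DecidableEq E] {G : RibbonGraph E}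
    (hG : G.IsOneVertex) (J : Finset E)
    (h : ∀ y, (0, y) ∈ (G.partialDual J).isotropicSystem → y = 0) :
    (G.partialDual J).IsOneVertex := by
  classical
  have key (z w : Corner E) : (G.partialDual J).vertexSetoid z w := by
    let P : Corner E → Prop := fun u => (G.partialDual J).vertexSetoid z u
    have hPatt (u) : P (attach u) = P u := propext
      ⟨fun hu => Setoid.trans' _ hu (Setoid.symm' _ (Relation.EqvGen.rel _ _ (Or.inl rfl))),
        fun hu => Setoid.trans' _ hu (Relation.EqvGen.rel _ _ (Or.inl rfl))⟩
    have hParc (u) : P ((G.partialDual J).arc u) = P u := propext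
      ⟨fun hu => Setoid.trans' _ hu (Setoid.symm' _ (Relation.EqvGen.rel _ _ (Or.inr rfl))),
        fun hu => Setoid.trans' _ hu (Relation.EqvGen.rel _ _ (Or.inr rfl))⟩
    let f : Corner E → ZMod 2 := fun u => if P u then 1 else 0
    have hatt (u) : f (attach u) = f u := by simp only [f, hPatt]
    have harc (u) : f ((G.partialDual J).arc u) = f u := by simp only [f, hParc]
    have hatt₁ (e : E) (a : Bool) : f (e, a, true) = f (e, a, false) := hatt (e, a, false)
    have hside (e : E) : f (e, false, false) = f (e, true, false) := by
      refine zmod_two_add_eq_zero.mp (congrFun (h (jump f).2 ⟨f, ⟨harc, fun e => ?_⟩, ?_⟩) e)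
      · rw [hatt₁, hatt₁, CharTwo.add_self_eq_zero, zero_add, CharTwo.add_self_eq_zero]
      · refine Prod.ext (funext fun e => ?_) rfl
        exact zmod_two_add_eq_zero.mpr (hatt₁ e false).symm
    have hribbon (u : Corner E) : f u = f (u.1, false, false) := by
      obtain ⟨e, a, s⟩ := u
      cases a <;> cases s <;> simp [hatt₁, hside]
    have hfst (u : Corner E) : (swapCorner J u).1 = u.1 := by
      unfold swapCorner
      split_ifs <;> rfl
    have hconst : f z = f w := by
      refine hG.eq_of_invariant (fun u => ?_) (fun u => ?_) z w
      · have h₁ := harc (swapCorner J u)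
        simp only [RibbonGraph.partialDual, swapCorner_swapCorner] at h₁
        rw [hribbon, hfst, hribbon (swapCorner J u), hfst] at h₁
        rw [hribbon, h₁, ← hribbon]
      · exact hatt u
    have hz : P z := Setoid.refl' _ z
    by_contra hw
    simp only [f, if_pos hz, if_neg (show ¬ P w from hw)] at hconst
    exact one_ne_zero hconst
  -- Both relations are total, and `isolated` is unchanged, so the vertex counts agree even when `E`
  -- is empty.
  have hset : (G.partialDual J).vertexSetoid = G.vertexSetoid :=
    Setoid.ext fun z w => ⟨fun _ => hG.vertexSetoid_apply z w, fun _ => key z w⟩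
  change Nat.card (Quotient (G.partialDual J).vertexSetoid ⊕ Fin G.isolated) = 1
  rw [hset]
  exact hG

/-! ### Block form and the principal pivot -/

/-- The rows and columns of a block matrix with respect to `J`. -/
def blockEquiv [DecidableEq E] (J : Finset E) : {i // i ∉ J} ⊕ {j // j ∈ J} ≃ E :=
  (Equiv.sumComm _ _).trans (Equiv.sumCompl (· ∈ J))

theorem blockForm_eq_submatrix [DecidableEq E] (J : Finset E) (M : Matrix E E (ZMod 2)) :
    blockForm J M = M.submatrix (blockEquiv J) (blockEquiv J) := by
  unfold blockForm
  congr 1 <;> ext (i | i) <;> rfl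

theorem eq_mulVec_iff_blockForm [Fintype E] [DecidableEq E] (J : Finset E)
    (M : Matrix E E (ZMod 2)) (x y : E → ZMod 2) :
    y = M.mulVec x ↔ y ∘ blockEquiv J = (blockForm J M).mulVec (x ∘ blockEquiv J) := by
  rw [blockForm_eq_submatrix, Matrix.submatrix_mulVec_equiv]
  have : (x ∘ blockEquiv J) ∘ (blockEquiv J).symm = x := by ext; simp
  rw [this]
  exact ((blockEquiv J).surjective.injective_comp_right.eq_iff).symm

/-- Exchanging a part of the arguments of a linear map with the corresponding part of the values
is the principal pivot transform. -/
theorem fromBlocks_mulVec_pivot {m n R : Type*} [Fintype m] [Fintype n] [DecidableEq n]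
    [CommRing R] [CharP R 2] (A : Matrix m m R) (B : Matrix m n R) (H : Matrix n n R)
    (hH : IsUnit H.det) (x y : m → R) (u v : n → R) :
    Sum.elim y u = (Matrix.fromBlocks A B B.transpose H).mulVec (Sum.elim x v) ↔
    Sum.elim y v = (Matrix.fromBlocks (A + B * H⁻¹ * B.transpose) (B * H⁻¹) (H⁻¹ * B.transpose)
      H⁻¹).mulVec (Sum.elim x u) := by
  simp only [Matrix.fromBlocks_mulVec, Sum.elim_comp_inl, Sum.elim_comp_inr, Sum.elim_eq_iff]
  have hB : B.transpose.mulVec x + B.transpose.mulVec x = 0 := by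
    ext
    exact CharTwo.add_self_eq_zero _
  -- Solve the `J`-rows for `v`; characteristic 2 removes the sign. The other rows follow by
  -- substitution.
  have h : u = B.transpose.mulVec x + H.mulVec v ↔
      v = (H⁻¹ * B.transpose).mulVec x + H⁻¹.mulVec u := by
    rw [← Matrix.mulVec_mulVec, ← Matrix.mulVec_add]
    constructor
    · rintro rfl
      rw [← add_assoc, hB, zero_add, Matrix.mulVec_mulVec, Matrix.nonsing_inv_mul _ hH,
        Matrix.one_mulVec]
    · rintro rfl
      rw [Matrix.mulVec_mulVec, Matrix.mul_nonsing_inv _ hH, Matrix.one_mulVec, ← add_assoc, hB,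
        zero_add]
  rw [h]
  refine and_congr_left ?_
  rintro rfl
  simp only [Matrix.mulVec_add, Matrix.add_mulVec, Matrix.mulVec_mulVec, Matrix.mul_assoc, add_assoc]

end RibbonGraph

theorem propositionp {E : Type*} [Fintype E] [DecidableEq E] (G : RibbonGraph E)
    (hG : G.IsOneVertex) (J : Finset E)
    (A : Matrix {i // i ∉ J} {i // i ∉ J} (ZMod 2))
    (B : Matrix {i // i ∉ J} {j // j ∈ J} (ZMod 2))
    (H : Matrix {j // j ∈ J} {j // j ∈ J} (ZMod 2))
    (hM : RibbonGraph.blockForm J G.intersectionMatrix = Matrix.fromBlocks A B B.transpose H)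
    (hH : H.det ≠ 0) :
    (G.partialDual J).IsOneVertex ∧
      RibbonGraph.blockForm J (G.partialDual J).intersectionMatrix =
        Matrix.fromBlocks (A + B * H⁻¹ * B.transpose) (B * H⁻¹) (H⁻¹ * B.transpose) H⁻¹ := by
  set N := Matrix.fromBlocks (A + B * H⁻¹ * B.transpose) (B * H⁻¹) (H⁻¹ * B.transpose) H⁻¹ with hN
  have hmem (x y : E → ZMod 2) : (x, y) ∈ (G.partialDual J).isotropicSystem ↔
      y ∘ RibbonGraph.blockEquiv J = N.mulVec (x ∘ RibbonGraph.blockEquiv J) := by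
    rw [RibbonGraph.mem_isotropicSystem_partialDual_iff, hG.mem_isotropicSystem_iff,
      RibbonGraph.eq_mulVec_iff_blockForm J, hM]
    have hI (x y : E → ZMod 2) : J.piecewise x y ∘ RibbonGraph.blockEquiv J =
        Sum.elim (fun i : {i // i ∉ J} => y i) (fun j : {j // j ∈ J} => x j) := by
      ext (i | j)
      · simp [RibbonGraph.blockEquiv, i.2]
      · simp [RibbonGraph.blockEquiv, j.2]
    have hI' (x : E → ZMod 2) : x ∘ RibbonGraph.blockEquiv J =
        Sum.elim (fun i : {i // i ∉ J} => x i) (fun j : {j // j ∈ J} => x j) := by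
      ext (i | j) <;> rfl
    rw [hI, hI, hI', hI' x, hN]
    exact RibbonGraph.fromBlocks_mulVec_pivot A B H hH.isUnit _ _ _ _
  have hone : (G.partialDual J).IsOneVertex := by
    refine hG.partialDual J fun y hy => ?_
    rw [hmem] at hy
    have h0 : ((0 : E → ZMod 2) ∘ RibbonGraph.blockEquiv J) = 0 := rfl
    rw [h0, Matrix.mulVec_zero] at hy
    ext e
    simpa using congrFun hy ((RibbonGraph.blockEquiv J).symm e)
  refine ⟨hone, Matrix.ext_of_mulVec_single fun i => ?_⟩
  -- Both matrices have the isotropic system of the dual as their graph, so they agree on unit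
  -- vectors.
  obtain ⟨x, hx⟩ : ∃ x : E → ZMod 2, x ∘ RibbonGraph.blockEquiv J = Pi.single i 1 :=
    ⟨Pi.single i 1 ∘ (RibbonGraph.blockEquiv J).symm, by ext; simp⟩
  have h := (hmem x _).mp ((hone.mem_isotropicSystem_iff x _).mpr rfl)
  rw [← hx, ← h, eq_comm]
  exact (RibbonGraph.eq_mulVec_iff_blockForm J _ _ _).mp rfl
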